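/- For finite sets $Q,R\subset\mathbb R\setminus\{0\}$ and a real $t>0$ put $\mathrm{Sym}_t^\times(Q,R)=\{x\in\mathbb R : |Q\cap xR^{-1}|\ge t\}$. For a finite nonempty set $A\subset\mathbb R\setminus\{0\}$ let $$d_*(A)=\min \frac{|Q|^2|R|^2}{|A|\,t^3},$$ where the minimum is over all real $t>0$ and all finite nonempty sets $Q,R\subset\mathbb R\setminus\{0\}$ such that $A\subseteq \mathrm{Sym}_t^\times(Q,R)$ and $\max\{|Q|,|R|\}\ge |A|$. A finite set $A\subset\mathbb R$ is said to be of Szemerédi–Trotter type with parameter $D>0$ if $$|\{s\in A-B : |A\cap(B+s)|\ge\tau\}|\le \frac{D|A||B|^2}{\tau^3}$$ for every finite set $B\subset\mathbb R$ and every real $\tau\ge1$. Then there is an absolute constant $C>0$ such that every finite nonempty set $A\subset\mathbb R\setminus\{0\}$ is of Szemerédi–Trotter type with parameter $C\,d_*(A)$. -/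

import Mathlib

open scoped Pointwise

noncomputable section

/-- The set `Sym_t^×(Q, R) = {x : |Q ∩ x R⁻¹| ≥ t}`. -/
def mulSym (t : ℝ) (Q R : Finset ℝ) : Set ℝ :=
  {x | t ≤ ((Q ∩ R.image (fun r => x * r⁻¹)).card : ℝ)}

/-- `(t, Q, R)` is admissible for `A`: `t > 0`, the sets `Q, R ⊂ ℝ ∖ {0}` are finite and nonempty,
`A ⊆ Sym_t^×(Q, R)` and `max {|Q|, |R|} ≥ |A|`. -/
structure MulSymAdmissible (A : Finset ℝ) (t : ℝ) (Q R : Finset ℝ) : Prop where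
  t_pos : 0 < t
  Q_nonempty : Q.Nonempty
  R_nonempty : R.Nonempty
  zero_notMem_Q : (0 : ℝ) ∉ Q
  zero_notMem_R : (0 : ℝ) ∉ R
  subset_mulSym : (A : Set ℝ) ⊆ mulSym t Q R
  card_le_max : A.card ≤ max Q.card R.card

/-- The set of all values `|Q|² |R|² / (|A| t³)` over the admissible `(t, Q, R)`. -/
def dStarValues (A : Finset ℝ) : Set ℝ :=
  {v | ∃ (t : ℝ) (Q R : Finset ℝ), MulSymAdmissible A t Q R ∧
    v = ((Q.card : ℝ) ^ 2 * (R.card : ℝ) ^ 2) / ((A.card : ℝ) * t ^ 3)}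

/-- The quantity `d_*(A)`, the minimum of `|Q|² |R|² / (|A| t³)` over the admissible `(t, Q, R)`.
It is meant for nonempty `A` with `0 ∉ A`. -/
def dStar (A : Finset ℝ) : ℝ := sInf (dStarValues A)

/-- A finite set `A` of reals is of Szemerédi–Trotter type with the parameter `D > 0` if
`|{s ∈ A - B : |A ∩ (B + s)| ≥ τ}| ≤ D |A| |B|² / τ³` for all finite `B` and all real `τ ≥ 1`. -/
def IsSzTType (A : Finset ℝ) (D : ℝ) : Prop :=
  0 < D ∧ ∀ (B : Finset ℝ) (τ : ℝ), 1 ≤ τ →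
    (({s ∈ A - B | τ ≤ ((A ∩ B.image (fun b => b + s)).card : ℝ)} : Finset ℝ).card : ℝ) ≤
      D * (A.card : ℝ) * (B.card : ℝ) ^ 2 / τ ^ 3

/-- The values are bounded below, so that the infimum in `dStar` is a genuine one. -/
theorem dStarValues_bddBelow (A : Finset ℝ) : BddBelow (dStarValues A) := by
  refine ⟨0, ?_⟩
  rintro v ⟨t, Q, R, h, rfl⟩
  have := h.t_pos
  positivity

/-- If `0 ∉ A` and `A` is nonempty then `Q = A`, `R = {1}`, `t = 1` is admissible. -/
theorem dStarValues_nonempty {A : Finset ℝ} (hA : A.Nonempty) (h0 : (0 : ℝ) ∉ A) :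
    (dStarValues A).Nonempty := by
  refine ⟨_, 1, A, {1}, ⟨one_pos, hA, Finset.singleton_nonempty _, h0, by simp, ?_, by simp⟩, rfl⟩
  intro x hx
  have hx' : x ∈ A := hx
  simp [mulSym, hx']

end

/-! If `a = q x` in at least `t` ways for each `a ∈ A`, and `s = a - b` in at least `τ` ways for
each popular difference `s ∈ S`, then the line `y = q x - b` passes through `(x, s)`. So `|Q||B|`
lines have at least `τ t |S|` incidences with `R × S` (`mul_card_le_grid_incidences`). A cell
partition of the grid bounds these incidences from above (`grid_incidences_real_le`): a monotone
line meets few cells, and two points lie on at most one common line. Optimising the number of cells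
gives `|S| ≤ 512 |Q|²|R|²|B|² / (τ³ t³)`, and the infimum over `(t, Q, R)` turns this into `dStar`.
-/

/-! ### Incidences of lines with a grid -/

open Finset in
/-- A finite set of reals splits into `r` consecutive blocks of size at most `|X| / r + 1`. -/
theorem exists_monotone_blocks (X : Finset ℝ) {r : ℕ} (hr : 0 < r) :
    ∃ f : ℝ → ℕ, Monotone f ∧ (∀ x ∈ X, f x < r) ∧
      ∀ j, (X.filter (fun x => f x = j)).card ≤ X.card / r + 1 := by
  set k := X.card / r + 1
  have hk0 : 0 < k := Nat.succ_pos _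
  set rk : ℝ → ℕ := fun x => (X.filter (· < x)).card
  have hmono : Monotone rk := by
    intro x y hxy
    apply card_le_card
    intro z hz
    simp only [mem_filter] at hz ⊢
    exact ⟨hz.1, hz.2.trans_le hxy⟩
  have hlt : ∀ x ∈ X, ∀ y, x < y → rk x < rk y := by
    intro x hx y hxy
    apply card_lt_card
    rw [ssubset_iff_of_subset]
    · exact ⟨x, by simp [hx, hxy], by simp⟩
    · intro z hz
      simp only [mem_filter] at hz ⊢
      exact ⟨hz.1, hz.2.trans hxy⟩
  -- The `+ 1` in `k` makes `r * k` exceed `|X|`, so every rank divided by `k` is below `r`.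
  refine ⟨fun x => rk x / k, fun x y hxy => Nat.div_le_div_right (hmono hxy), ?_, ?_⟩
  · intro x hx
    have h1 : rk x < X.card := by
      apply card_lt_card
      rw [ssubset_iff_of_subset (filter_subset _ _)]
      exact ⟨x, hx, by simp⟩
    rw [Nat.div_lt_iff_lt_mul hk0]
    have h2 : X.card < r * k := by
      exact Nat.lt_mul_div_succ _ hr
    omega
  · intro j
    have : (X.filter (fun x => rk x / k = j)).card ≤ (Finset.Ico (j * k) (j * k + k)).card := by
      apply card_le_card_of_injOn rk
      · intro x hx
        simp only [coe_filter, Set.mem_ofPred_eq] at hx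
        have := hx.2
        rw [Nat.div_eq_iff hk0] at this
        simp only [coe_Ico, Set.mem_Ico]
        omega
      · intro x hx y hy hxy
        simp only [coe_filter, Set.mem_ofPred_eq] at hx hy
        rcases lt_trichotomy x y with h | h | h
        · exact absurd hxy (hlt x hx.1 y h).ne
        · exact h
        · exact absurd hxy (hlt y hy.1 x h).ne'
    simpa using this

open Finset in
/-- A finite set has at most as many elements as a map on it has values, plus the number of its
ordered pairs of distinct elements with the same value. -/
theorem card_le_card_image_add_card_collisions {α β : Type*} [DecidableEq α] [DecidableEq β]
    (P : Finset α) (φ : α → β) :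
    P.card ≤ (P.image φ).card + (P.offDiag.filter (fun p => φ p.1 = φ p.2)).card := by
  induction P using Finset.induction_on with
  | empty => simp
  | insert a P ha ih =>
    rw [card_insert_of_notMem ha, image_insert]
    have hsub : P.offDiag.filter (fun p => φ p.1 = φ p.2) ⊆
        (insert a P).offDiag.filter (fun p => φ p.1 = φ p.2) :=
      filter_subset_filter _ (offDiag_mono (subset_insert _ _))
    by_cases h : φ a ∈ P.image φ
    · rw [insert_eq_of_mem h]
      obtain ⟨b, hb, hab⟩ := mem_image.1 h
      have : (P.offDiag.filter (fun p => φ p.1 = φ p.2)).card <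
          ((insert a P).offDiag.filter (fun p => φ p.1 = φ p.2)).card := by
        apply card_lt_card
        rw [ssubset_iff_of_subset hsub]
        refine ⟨(a, b), ?_, ?_⟩
        · simp only [mem_filter, mem_offDiag, mem_insert]
          exact ⟨⟨by simp, Or.inr hb, fun e => ha (e ▸ hb)⟩, hab.symm⟩
        · simp [ha]
      omega
    · rw [card_insert_of_notMem h]
      have := card_le_card hsub
      omega

open Finset in
/-- A line of nonzero slope meets at most `2 r` cells of an `r × r` grid of blocks. -/
theorem card_cells_on_line_le (X Y : Finset ℝ) {r : ℕ} {f g : ℝ → ℕ} (hf : Monotone f)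
    (hg : Monotone g) (hfr : ∀ x ∈ X, f x < r) (hgr : ∀ y ∈ Y, g y < r) {m : ℝ} (c : ℝ) :
    ((X.filter (fun x => m * x + c ∈ Y)).image (fun x => (f x, g (m * x + c)))).card ≤ 2 * r := by
  set P := X.filter (fun x => m * x + c ∈ Y) with hP
  have hPm : ∀ x ∈ P, f x < r ∧ g (m * x + c) < r := fun x hx =>
    ⟨hfr x (mem_filter.1 hx).1, hgr _ (mem_filter.1 hx).2⟩
  rcases le_total 0 m with hm | hm
  · have : ((P.image (fun x => (f x, g (m * x + c))))).card ≤ (range (2 * r)).card := by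
      -- Along a nondecreasing line both cell indices grow weakly, so their sum determines the cell.
      apply card_le_card_of_injOn (fun p => p.1 + p.2)
      · intro p hp
        obtain ⟨x, hx, rfl⟩ := mem_image.1 (mem_coe.1 hp)
        have := hPm x hx
        simp only [coe_range, Set.mem_Iio]
        omega
      · intro p hp q hq hpq
        obtain ⟨x, hx, rfl⟩ := mem_image.1 (mem_coe.1 hp)
        obtain ⟨y, hy, rfl⟩ := mem_image.1 (mem_coe.1 hq)
        simp only [Prod.mk.injEq] at hpq ⊢
        rcases le_total x y with h | h
        · have h1 := hf h
          have h2 := hg (add_le_add_left (mul_le_mul_of_nonneg_left h hm) c)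
          omega
        · have h1 := hf h
          have h2 := hg (add_le_add_left (mul_le_mul_of_nonneg_left h hm) c)
          omega
    simpa using this
  · have : ((P.image (fun x => (f x, g (m * x + c))))).card ≤ (range (2 * r)).card := by
      -- For a nonincreasing line the second index is reversed.
      apply card_le_card_of_injOn (fun p => p.1 + (r - p.2))
      · intro p hp
        obtain ⟨x, hx, rfl⟩ := mem_image.1 (mem_coe.1 hp)
        have := hPm x hx
        simp only [coe_range, Set.mem_Iio]
        omega
      · intro p hp q hq hpq
        obtain ⟨x, hx, rfl⟩ := mem_image.1 (mem_coe.1 hp)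
        obtain ⟨y, hy, rfl⟩ := mem_image.1 (mem_coe.1 hq)
        have hx' := hPm x hx
        have hy' := hPm y hy
        simp only [Prod.mk.injEq] at hpq ⊢
        rcases le_total x y with h | h
        · have h1 := hf h
          have h2 := hg (add_le_add_left (mul_le_mul_of_nonpos_left h hm) c)
          omega
        · have h1 := hf h
          have h2 := hg (add_le_add_left (mul_le_mul_of_nonpos_left h hm) c)
          omega
    simpa using this

open Finset in
/-- The number of ordered pairs in the same block is at most `|X|` times the largest block. -/
theorem card_pairs_same_block_le (X : Finset ℝ) (f : ℝ → ℕ) {k : ℕ}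
    (hk : ∀ j, (X.filter (fun x => f x = j)).card ≤ k) :
    ((X ×ˢ X).filter (fun p => f p.1 = f p.2)).card ≤ X.card * k := by
  have h : ((X ×ˢ X).filter (fun p => f p.1 = f p.2)) ⊆
      (X.sigma (fun x => X.filter (fun y => f y = f x))).image (fun p => (p.1, p.2)) := by
    rintro ⟨x, y⟩ hp
    simp only [mem_filter, mem_product] at hp
    simp only [mem_image, mem_sigma, mem_filter]
    exact ⟨⟨x, y⟩, ⟨hp.1.1, hp.1.2, hp.2.symm⟩, rfl⟩
  refine (card_le_card h).trans (card_image_le.trans ?_)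
  rw [card_sigma, ← smul_eq_mul]
  exact sum_le_card_nsmul _ _ _ fun x _ => hk _

open Finset in
/-- Incidences of the grid `X × Y` with the lines `y = m x + c`, `(m, c) ∈ L`, by partitioning the
grid into `r × r` cells. -/
theorem card_grid_incidences_le (X Y : Finset ℝ) (L : Finset (ℝ × ℝ)) {r : ℕ} (hr : 0 < r) :
    ∑ l ∈ L, (X.filter (fun x => l.1 * x + l.2 ∈ Y)).card ≤
      2 * r * L.card + X.card * (X.card / r + 1) * (Y.card * (Y.card / r + 1)) := by
  obtain ⟨f, hf, hfr, hfk⟩ := exists_monotone_blocks X hr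
  obtain ⟨g, hg, hgr, hgk⟩ := exists_monotone_blocks Y hr
  set col : ℝ × ℝ → Finset (ℝ × ℝ) := fun l =>
    (X.filter (fun x => l.1 * x + l.2 ∈ Y)).offDiag.filter
      (fun p => (f p.1, g (l.1 * p.1 + l.2)) = (f p.2, g (l.1 * p.2 + l.2))) with hcol
  have h1 : ∑ l ∈ L, (X.filter (fun x => l.1 * x + l.2 ∈ Y)).card ≤
      ∑ l ∈ L, (2 * r + (col l).card) := by
    refine sum_le_sum fun l _ => ?_
    refine (card_le_card_image_add_card_collisions _
      (fun x => (f x, g (l.1 * x + l.2)))).trans ?_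
    exact Nat.add_le_add_right (card_cells_on_line_le X Y hf hg hfr hgr l.2) _
  -- Two points with distinct abscissas determine `(m, c)`, so each pair of grid points in a common
  -- cell is counted for at most one line.
  have h2 : ∑ l ∈ L, (col l).card ≤
      (((X ×ˢ X).filter (fun p => f p.1 = f p.2)) ×ˢ
        ((Y ×ˢ Y).filter (fun p => g p.1 = g p.2))).card := by
    rw [← card_sigma]
    apply card_le_card_of_injOn
      (fun p => (p.2, (p.1.1 * p.2.1 + p.1.2, p.1.1 * p.2.2 + p.1.2)))
    · rintro ⟨l, p⟩ hp
      simp only [hcol, coe_sigma, Set.mem_sigma_iff, mem_coe, mem_filter, mem_offDiag,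
        Prod.mk.injEq] at hp
      simp only [coe_product, Set.mem_prod, mem_coe, mem_filter, mem_product]
      tauto
    · rintro ⟨⟨m, c⟩, ⟨x, y⟩⟩ hp ⟨⟨m', c'⟩, ⟨x', y'⟩⟩ hp' h
      simp only [hcol, coe_sigma, Set.mem_sigma_iff, mem_coe, mem_filter, mem_offDiag] at hp
      simp only [Prod.mk.injEq] at h
      obtain ⟨⟨rfl, rfl⟩, h3, h4⟩ := h
      have hne : x - y ≠ 0 := sub_ne_zero.2 hp.2.1.2.2
      have hm : m = m' := by
        apply mul_right_cancel₀ hne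
        linear_combination h3 - h4
      subst hm
      have hc : c = c' := by linarith
      subst hc
      rfl
  rw [card_product] at h2
  have h3 := Nat.mul_le_mul (card_pairs_same_block_le X f hfk) (card_pairs_same_block_le Y g hgk)
  rw [sum_add_distrib, sum_const, smul_eq_mul] at h1
  linarith [h1, h2, h3, mul_comm L.card (2 * r)]

open Finset in
/-- Nonzero-slope lines meet the grid `X × Y` in at most `|X|` and at most `|Y|` points each. -/
theorem card_grid_incidences_le_min_mul (X Y : Finset ℝ) (L : Finset (ℝ × ℝ))
    (hL : ∀ l ∈ L, l.1 ≠ 0) :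
    ∑ l ∈ L, (X.filter (fun x => l.1 * x + l.2 ∈ Y)).card ≤ min X.card Y.card * L.card := by
  rw [mul_comm, ← smul_eq_mul]
  refine sum_le_card_nsmul _ _ _ fun l hl => le_min (card_filter_le _ _) ?_
  apply card_le_card_of_injOn (fun x => l.1 * x + l.2)
  · intro x hx
    exact (mem_filter.1 (mem_coe.1 hx)).2
  · intro x _ y _ h
    exact mul_left_cancel₀ (hL l hl) (add_right_cancel h)

/-- Incidence bound for nonzero-slope lines on a grid, with a free parameter `r`. -/
theorem grid_incidences_real_le (X Y : Finset ℝ) (L : Finset (ℝ × ℝ))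
    (hL : ∀ l ∈ L, l.1 ≠ 0) {r : ℕ} (hr : 0 < r) :
    ((∑ l ∈ L, (X.filter (fun x => l.1 * x + l.2 ∈ Y)).card : ℕ) : ℝ) ≤
      2 * r * L.card + 4 * (X.card : ℝ) ^ 2 * (Y.card : ℝ) ^ 2 / (r : ℝ) ^ 2 := by
  have hr' : (0 : ℝ) < r := by exact_mod_cast hr
  -- For `r ≤ n` the block size `n / r + 1` is at most `2 n / r`; for larger `r` the trivial bound
  -- on points per line suffices.
  by_cases h : r ≤ min X.card Y.card
  · have hblock : ∀ n : ℕ, r ≤ n → ((n / r + 1 : ℕ) : ℝ) ≤ 2 * n / r := by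
      intro n hn
      have h1 : ((n / r : ℕ) : ℝ) ≤ n / r := Nat.cast_div_le
      have h2 : (1 : ℝ) ≤ n / r := by
        rw [one_le_div hr']
        exact_mod_cast hn
      push_cast
      calc ((n / r : ℕ) : ℝ) + 1 ≤ n / r + n / r := add_le_add h1 h2
        _ = 2 * n / r := by ring
    have hX := hblock _ (h.trans (min_le_left _ _))
    have hY := hblock _ (h.trans (min_le_right _ _))
    have hI : ((∑ l ∈ L, (X.filter (fun x => l.1 * x + l.2 ∈ Y)).card : ℕ) : ℝ) ≤
        2 * r * L.card + X.card * ((X.card / r + 1 : ℕ) : ℝ) *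
          (Y.card * ((Y.card / r + 1 : ℕ) : ℝ)) := by
      exact_mod_cast card_grid_incidences_le X Y L hr
    refine hI.trans ?_
    have : (X.card : ℝ) * ((X.card / r + 1 : ℕ) : ℝ) * (Y.card * ((Y.card / r + 1 : ℕ) : ℝ)) ≤
        X.card * (2 * X.card / r) * (Y.card * (2 * Y.card / r)) := by gcongr
    refine (add_le_add_right this _).trans (le_of_eq ?_)
    field_simp
    ring
  · have h1 : min X.card Y.card * L.card ≤ r * L.card := Nat.mul_le_mul_right _ (by omega)
    have h2 : ((∑ l ∈ L, (X.filter (fun x => l.1 * x + l.2 ∈ Y)).card : ℕ) : ℝ) ≤ r * L.card := by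
      exact_mod_cast (card_grid_incidences_le_min_mul X Y L hL).trans h1
    have h3 : (0 : ℝ) ≤ 4 * (X.card : ℝ) ^ 2 * (Y.card : ℝ) ^ 2 / (r : ℝ) ^ 2 := by positivity
    have h4 : (0 : ℝ) ≤ r * L.card := by positivity
    linarith

/-! ### From representations to popular differences -/

open Finset in
/-- If every `a ∈ A` has at least `t` representations `a = q r` and every `s ∈ S` at least `τ`
representations `s = a - b`, then the lines `y = q x - b` have at least `τ t |S|` incidences with
`R × S`. -/
theorem mul_card_le_grid_incidences (A B Q R S : Finset ℝ) {t τ : ℝ} (ht : 0 ≤ t)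
    (hA : ∀ a ∈ A, t ≤ (((Q ×ˢ R).filter (fun p => p.1 * p.2 = a)).card : ℝ))
    (hS : ∀ s ∈ S, τ ≤ ((A ∩ B.image (fun b => b + s)).card : ℝ)) :
    τ * t * S.card ≤ ((∑ l ∈ Q ×ˢ B.image (fun b => -b),
      (R.filter (fun x => l.1 * x + l.2 ∈ S)).card : ℕ) : ℝ) := by
  set T : ℝ → Finset (Σ _ : ℝ, ℝ × ℝ) := fun s =>
    (A ∩ B.image (fun b => b + s)).sigma (fun a => (Q ×ˢ R).filter (fun p => p.1 * p.2 = a)) with hT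
  have h1 : ∀ s ∈ S, τ * t ≤ ((T s).card : ℝ) := by
    intro s hs
    calc τ * t ≤ ((A ∩ B.image (fun b => b + s)).card : ℝ) * t :=
          mul_le_mul_of_nonneg_right (hS s hs) ht
      _ = ∑ a ∈ A ∩ B.image (fun b => b + s), t := by simp
      _ ≤ ∑ a ∈ A ∩ B.image (fun b => b + s),
          (((Q ×ˢ R).filter (fun p => p.1 * p.2 = a)).card : ℝ) :=
          sum_le_sum fun a ha => hA a (mem_inter.1 ha).1
      _ = ((T s).card : ℝ) := by rw [hT, card_sigma]; push_cast; rfl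
  have h2 : (S.sigma T).card ≤ ((Q ×ˢ B.image (fun b => -b)).sigma
      (fun l => R.filter (fun x => l.1 * x + l.2 ∈ S))).card := by
    -- The intercept is `s - a = -b`; slope and abscissa recover `a = q x`, and then `s`.
    apply card_le_card_of_injOn (fun p => ⟨(p.2.2.1, p.1 - p.2.1), p.2.2.2⟩)
    · rintro ⟨s, a, q, x⟩ h
      simp only [hT, coe_sigma, Set.mem_sigma_iff, mem_coe, mem_inter, mem_image,
        mem_filter, mem_product] at h
      obtain ⟨hs, ⟨-, b, hb, hba⟩, ⟨hq, hx⟩, hqx⟩ := h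
      simp only [coe_sigma, Set.mem_sigma_iff, mem_coe, mem_filter, mem_product, mem_image]
      refine ⟨⟨hq, b, hb, by linarith⟩, hx, ?_⟩
      have : q * x + (s - a) = s := by linarith
      rwa [this]
    · rintro ⟨s, a, q, x⟩ h ⟨s', a', q', x'⟩ h' e
      simp only [hT, coe_sigma, Set.mem_sigma_iff, mem_coe, mem_filter] at h h'
      simp only [Sigma.mk.injEq, Prod.mk.injEq, heq_eq_eq] at e
      obtain ⟨⟨rfl, e1⟩, rfl⟩ := e
      have ha : a = a' := h.2.2.2.symm.trans h'.2.2.2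
      subst ha
      have hs : s = s' := by linarith
      subst hs
      rfl
  rw [card_sigma, card_sigma] at h2
  calc τ * t * S.card = ∑ s ∈ S, τ * t := by simp [mul_comm]
    _ ≤ ∑ s ∈ S, ((T s).card : ℝ) := sum_le_sum h1
    _ ≤ _ := by exact_mod_cast h2

/-- Choosing the number `r` of blocks so that the term `2 r N` is absorbed. -/
theorem le_of_forall_incidence_bound {τ t s N ρ : ℝ} (hτ : 0 < τ) (ht : 0 < t) (hs : 0 < s)
    (hN : 0 < N) (hτN : τ ^ 2 ≤ N) (htρ : t ≤ ρ)
    (h : ∀ r : ℕ, 0 < r → τ * t * s ≤ 2 * r * N + 4 * ρ ^ 2 * s ^ 2 / (r : ℝ) ^ 2) :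
    s * (τ ^ 3 * t ^ 3) ≤ 512 * (N ^ 2 * ρ ^ 2) := by
  -- With this `u`, the term `2 u N` is half of `τ t s`. If `u < 1` no block count fits below it,
  -- but then `τ² ≤ N` and `t ≤ ρ` already suffice.
  set u : ℝ := τ * t * s / (4 * N) with hu
  have huN : τ * t * s = 4 * N * u := by rw [hu]; field_simp
  have hupos : 0 < u := by positivity
  rcases lt_or_ge u 1 with h1 | h1
  · have htρ2 : t ^ 2 ≤ ρ ^ 2 := by gcongr
    calc s * (τ ^ 3 * t ^ 3) = (τ * t * s) * (τ ^ 2 * t ^ 2) := by ring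
      _ ≤ (4 * N) * (N * ρ ^ 2) := by
          apply mul_le_mul _ (mul_le_mul hτN htρ2 (by positivity) hN.le) (by positivity)
            (by positivity)
          rw [huN]
          nlinarith
      _ ≤ 512 * (N ^ 2 * ρ ^ 2) := by
          have : 0 ≤ N ^ 2 * ρ ^ 2 := by positivity
          linarith
  · have hr : 0 < ⌊u⌋₊ := Nat.floor_pos.2 h1
    have hru : (⌊u⌋₊ : ℝ) ≤ u := Nat.floor_le hupos.le
    have hur : u / 2 ≤ (⌊u⌋₊ : ℝ) := by
      have h2 := Nat.lt_floor_add_one u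
      have h3 : (1 : ℝ) ≤ ⌊u⌋₊ := by exact_mod_cast hr
      linarith
    have hup := h _ hr
    have h2 : 2 * (⌊u⌋₊ : ℝ) * N ≤ 2 * N * u := by nlinarith
    have h3 : 4 * ρ ^ 2 * s ^ 2 / (⌊u⌋₊ : ℝ) ^ 2 ≤ 4 * ρ ^ 2 * s ^ 2 / (u / 2) ^ 2 := by gcongr
    have h4 : 2 * N * u ≤ 4 * ρ ^ 2 * s ^ 2 / (u / 2) ^ 2 := by linarith
    rw [le_div_iff₀ (by positivity)] at h4
    have h5 : N * u ^ 3 ≤ 8 * (ρ ^ 2 * s ^ 2) := by nlinarith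
    have h6 : s ^ 2 * (s * (τ ^ 3 * t ^ 3)) ≤ s ^ 2 * (512 * (N ^ 2 * ρ ^ 2)) := by
      calc s ^ 2 * (s * (τ ^ 3 * t ^ 3)) = (τ * t * s) ^ 3 := by ring
        _ = 64 * N ^ 2 * (N * u ^ 3) := by rw [huN]; ring
        _ ≤ 64 * N ^ 2 * (8 * (ρ ^ 2 * s ^ 2)) := by gcongr
        _ = _ := by ring
    exact le_of_mul_le_mul_left h6 (by positivity)

open Finset in
/-- Popular differences of a set with many multiplicative representations, when `|A| ≤ |Q|`. -/
theorem card_popular_le_of_card_le (A B Q R S : Finset ℝ) {t τ : ℝ} (ht : 0 < t) (hτ : 0 < τ)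
    (hQ0 : (0 : ℝ) ∉ Q) (hR0 : (0 : ℝ) ∉ R) (hAQ : A.card ≤ Q.card)
    (hA : ∀ a ∈ A, t ≤ (((Q ×ˢ R).filter (fun p => p.1 * p.2 = a)).card : ℝ))
    (hS : ∀ s ∈ S, τ ≤ ((A ∩ B.image (fun b => b + s)).card : ℝ)) :
    (S.card : ℝ) ≤ 512 * ((Q.card : ℝ) ^ 2 * (R.card : ℝ) ^ 2 * (B.card : ℝ) ^ 2) /
      (τ ^ 3 * t ^ 3) := by
  rcases S.eq_empty_or_nonempty with rfl | ⟨s, hs⟩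
  · simp only [card_empty, Nat.cast_zero]
    positivity
  have hSpos : (0 : ℝ) < S.card := by exact_mod_cast card_pos.2 ⟨s, hs⟩
  have hτA : τ ≤ A.card := (hS s hs).trans (by exact_mod_cast card_le_card inter_subset_left)
  have hτB : τ ≤ B.card := (hS s hs).trans
    (by exact_mod_cast (card_le_card inter_subset_right).trans card_image_le)
  have hAQ' : (A.card : ℝ) ≤ Q.card := by exact_mod_cast hAQ
  have hBpos : (0 : ℝ) < B.card := hτ.trans_le hτB
  have hQpos : (0 : ℝ) < Q.card := hτ.trans_le (hτA.trans hAQ')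
  obtain ⟨a, ha⟩ : A.Nonempty := card_pos.1 (by exact_mod_cast hτ.trans_le hτA)
  have htR : t ≤ R.card := by
    refine (hA a ha).trans ?_
    norm_cast
    apply card_le_card_of_injOn Prod.snd
    · intro p hp
      simp only [coe_filter, mem_product, Set.mem_ofPred_eq] at hp
      exact hp.1.2
    · rintro ⟨q, x⟩ hp ⟨q', x'⟩ hp' e
      simp only [coe_filter, mem_product, Set.mem_ofPred_eq] at hp hp' e
      subst e
      have hx : x ≠ 0 := fun h => hR0 (h ▸ hp.1.2)
      rw [mul_right_cancel₀ hx (hp.2.trans hp'.2.symm)]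
  have hlow := mul_card_le_grid_incidences A B Q R S ht.le hA hS
  set L := Q ×ˢ B.image (fun b => -b) with hLdef
  have hLcard : (L.card : ℝ) = Q.card * B.card := by
    rw [hLdef, card_product, card_image_of_injective _ neg_injective]
    push_cast; rfl
  have hL : ∀ l ∈ L, l.1 ≠ 0 := by
    intro l hl h
    exact hQ0 (h ▸ (mem_product.1 hl).1)
  have hup : ∀ r : ℕ, 0 < r → τ * t * S.card ≤
      2 * r * (Q.card * B.card) + 4 * (R.card : ℝ) ^ 2 * (S.card : ℝ) ^ 2 / (r : ℝ) ^ 2 := by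
    intro r hr
    rw [← hLcard]
    exact hlow.trans (grid_incidences_real_le R S L hL hr)
  -- This is where `|A| ≤ |Q|` enters.
  have hτN : τ ^ 2 ≤ Q.card * B.card := by
    rw [sq]
    exact mul_le_mul (hτA.trans hAQ') hτB hτ.le hQpos.le
  have := le_of_forall_incidence_bound hτ ht hSpos (mul_pos hQpos hBpos) hτN htR hup
  rw [mul_pow] at this
  rw [le_div_iff₀ (mul_pos (pow_pos hτ 3) (pow_pos ht 3))]
  linarith

open Finset in
theorem le_card_factorizations_of_mem_mulSym {t x : ℝ} {Q R : Finset ℝ} (hR0 : (0 : ℝ) ∉ R)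
    (hx : x ∈ mulSym t Q R) :
    t ≤ (((Q ×ˢ R).filter (fun p => p.1 * p.2 = x)).card : ℝ) := by
  have hx' : t ≤ ((Q ∩ R.image (fun r => x * r⁻¹)).card : ℝ) := hx
  refine hx'.trans ?_
  norm_cast
  apply card_le_card_of_surjOn Prod.fst
  intro q hq
  simp only [coe_inter, coe_image, Set.mem_inter_iff, mem_coe, Set.mem_image] at hq
  obtain ⟨hq, r, hr, rfl⟩ := hq
  have hr0 : r ≠ 0 := fun h => hR0 (h ▸ hr)
  refine ⟨(x * r⁻¹, r), ?_, rfl⟩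
  simp [hq, hr, hr0]

-- Factorizations are symmetric in `Q` and `R`, so whichever set has at least `|A|` elements can
-- supply the slopes.
open Finset in
theorem card_popular_le (A B Q R S : Finset ℝ) {t τ : ℝ} (h : MulSymAdmissible A t Q R)
    (hτ : 0 < τ) (hS : ∀ s ∈ S, τ ≤ ((A ∩ B.image (fun b => b + s)).card : ℝ)) :
    (S.card : ℝ) ≤ 512 * ((Q.card : ℝ) ^ 2 * (R.card : ℝ) ^ 2 * (B.card : ℝ) ^ 2) /
      (τ ^ 3 * t ^ 3) := by
  have hA : ∀ a ∈ A, t ≤ (((Q ×ˢ R).filter (fun p => p.1 * p.2 = a)).card : ℝ) := fun a ha =>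
    le_card_factorizations_of_mem_mulSym h.zero_notMem_R (h.subset_mulSym ha)
  rcases le_max_iff.1 h.card_le_max with hQ | hR
  · exact card_popular_le_of_card_le A B Q R S h.t_pos hτ h.zero_notMem_Q h.zero_notMem_R hQ hA hS
  · rw [mul_comm ((Q.card : ℝ) ^ 2)]
    refine card_popular_le_of_card_le A B R Q S h.t_pos hτ h.zero_notMem_R h.zero_notMem_Q hR
      (fun a ha => (hA a ha).trans ?_) hS
    norm_cast
    apply card_le_card_of_injOn Prod.swap
    · intro p hp
      simp only [coe_filter, mem_product, Set.mem_ofPred_eq, Prod.fst_swap, Prod.snd_swap] at hp ⊢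
      exact ⟨hp.1.symm, by rw [mul_comm]; exact hp.2⟩
    · exact Prod.swap_injective.injOn

/-! ### Passing to the infimum -/

-- Supplies the positivity of the parameter. Each value is at least 1 because `t ≤ min |Q| |R|` and
-- `|A| ≤ max |Q| |R|`.
open Finset in
theorem one_le_dStar {A : Finset ℝ} (hA : A.Nonempty) (h0 : (0 : ℝ) ∉ A) : 1 ≤ dStar A := by
  refine le_csInf (dStarValues_nonempty hA h0) ?_
  rintro v ⟨t, Q, R, h, rfl⟩
  obtain ⟨a, ha⟩ := hA
  have ht := h.t_pos
  have hcard : (0 : ℝ) < A.card := by exact_mod_cast card_pos.2 ⟨a, ha⟩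
  have hmem : t ≤ ((Q ∩ R.image (fun r => a * r⁻¹)).card : ℝ) := h.subset_mulSym ha
  have htQ : t ≤ Q.card := hmem.trans (by exact_mod_cast card_le_card inter_subset_left)
  have htR : t ≤ R.card := hmem.trans
    (by exact_mod_cast (card_le_card inter_subset_right).trans card_image_le)
  rw [one_le_div (by positivity)]
  rcases le_max_iff.1 h.card_le_max with hm | hm
  · have hm' : (A.card : ℝ) ≤ Q.card := by exact_mod_cast hm
    calc (A.card : ℝ) * t ^ 3 = A.card * t * t ^ 2 := by ring
      _ ≤ Q.card * Q.card * (R.card : ℝ) ^ 2 := by gcongr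
      _ = _ := by ring
  · have hm' : (A.card : ℝ) ≤ R.card := by exact_mod_cast hm
    calc (A.card : ℝ) * t ^ 3 = t ^ 2 * (A.card * t) := by ring
      _ ≤ (Q.card : ℝ) ^ 2 * (R.card * R.card) := by gcongr
      _ = _ := by ring

theorem lemma13 :
    ∃ C : ℝ, 0 < C ∧ ∀ A : Finset ℝ, A.Nonempty → (0 : ℝ) ∉ A →
      IsSzTType A (C * dStar A) := by
  refine ⟨512, by norm_num, fun A hA h0 => ⟨?_, fun B τ hτ => ?_⟩⟩
  · have := one_le_dStar hA h0
    linarith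
  have hτ0 : 0 < τ := one_pos.trans_le hτ
  have hcard : (0 : ℝ) < A.card := by exact_mod_cast Finset.card_pos.2 hA
  set S : Finset ℝ := {s ∈ A - B | τ ≤ ((A ∩ B.image (fun b => b + s)).card : ℝ)} with hSdef
  have hS : ∀ s ∈ S, τ ≤ ((A ∩ B.image (fun b => b + s)).card : ℝ) := fun s hs =>
    (Finset.mem_filter.1 hs).2
  rcases B.eq_empty_or_nonempty with rfl | hB
  · simp [hSdef]
  have hBcard : (0 : ℝ) < B.card := by exact_mod_cast Finset.card_pos.2 hB
  -- Solved for `dStar`, the bound is a lower bound for all values, so the infimum need not be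
  -- attained.
  have key : (S.card : ℝ) * τ ^ 3 / (512 * A.card * (B.card : ℝ) ^ 2) ≤ dStar A := by
    refine le_csInf (dStarValues_nonempty hA h0) ?_
    rintro v ⟨t, Q, R, h, rfl⟩
    have ht := h.t_pos
    have := card_popular_le A B Q R S h hτ0 hS
    rw [le_div_iff₀ (by positivity)] at this
    rw [div_le_div_iff₀ (by positivity) (by positivity)]
    calc (S.card : ℝ) * τ ^ 3 * (A.card * t ^ 3) = A.card * (S.card * (τ ^ 3 * t ^ 3)) := by ring
      _ ≤ A.card * (512 * ((Q.card : ℝ) ^ 2 * (R.card : ℝ) ^ 2 * (B.card : ℝ) ^ 2)) := by gcongr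
      _ = _ := by ring
  rw [div_le_iff₀ (by positivity)] at key
  rw [le_div_iff₀ (by positivity)]
  linarith
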